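/- Let $n\ge 1$. Let $\mathcal B_n$ be the Artin braid group with generators $x_1,\dots,x_{n-1}$ and relations $x_ix_j=x_jx_i$ for $|i-j|\ne 1$, $x_{i+1}x_ix_{i+1}=x_ix_{i+1}x_i$, let $\mathcal{MB}_n$ be the monoid of positive braids (the monoid with the same presentation) with natural map $\iota:\mathcal{MB}_n\to\mathcal B_n$, and let $\pi:\mathcal B_n\to\Sigma_n$ be the canonical projection $x_i\mapsto(i\ \,i{+}1)$ to the symmetric group. Let $\Delta_n=x_1(x_2x_1)\cdots(x_{n-1}x_{n-2}\cdots x_1)\in\mathcal{MB}_n$, and let $\mathrm{Div}(\Delta_n)=\{\alpha\in\mathcal{MB}_n : \Delta_n=\delta\alpha\varepsilon \text{ for some }\delta,\varepsilon\in\mathcal{MB}_n\}$. Let $\mathcal{SB}_n\subset\mathcal{MB}_n$ be the set of simple braids, i.e. of positive braids represented by a word $x_{i_1}\cdots x_{i_k}$ with pairwise distinct indices. For $A\subset\mathcal{MB}_n$ let $A/_\sim$ be the set of conjugacy classes of $\mathcal B_n$ that intersect $\iota(A)$; $\mathcal B_n/_\sim$ and $\Sigma_n/_\sim$ are the sets of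 conjugacy classes of these groups. Then $\mathcal{SB}_n\subset\mathrm{Div}(\Delta_n)$. There is a natural section $s:\Sigma_n\to\mathrm{Div}(\Delta_n)$ that sends $\sigma$ to the positive braid represented by any reduced word of $\sigma$ (a shortest expression of $\sigma$ in the adjacent transpositions $(i\ \,i{+}1)$, read as a word in the $x_i$); this braid divides $\Delta_n$ and does not depend on the reduced word. The diagram $$\begin{array}{ccccccccc} \mathcal{SB}_n & \hookrightarrow & \mathrm{Div}(\Delta_n) & \hookrightarrow & \mathcal{MB}_n & \xrightarrow{\ \iota\ } & \mathcal B_n & \xrightarrow{\ \pi\ } & \Sigma_n\\ \downarrow && \downarrow && \downarrow && \downarrow && \downarrow\\ \mathcal{SB}_n/_\sim & \hookrightarrow & \mathrm{Div}(\Delta_n)/_\sim & \hookrightarrow & \mathcal{MB}_n/_\sim & \hookrightarrow & \mathcal B_n/_\sim & \longrightarrow & \Sigma_n/_\sim \end{array}$$ commutes, where the vertical maps send an element to its conjugacy class and the last lower map is induced by $\pi$. The composite $\pi':\mathcal{SB}_n/_\sim\to\Sigma_n/_\sim$ of the lower row is the map induced by $\pi$, i.e. it sends the class of $\alpha\in\mathcal{SB}_n$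 to the class of $\pi(\iota(\alpha))$. The map $s$ is a two-sided inverse of the restricted projection: $\pi\circ\iota\circ s=\mathrm{id}_{\Sigma_n}$ and $s\circ\pi\circ\iota|_{\mathrm{Div}(\Delta_n)}=\mathrm{id}$. Both $s:\Sigma_n\to\mathrm{Div}(\Delta_n)$ and $\pi':\mathcal{SB}_n/_\sim\to\Sigma_n/_\sim$ are bijections. -/

import Mathlib

namespace SimpleBraids

/-- The Artin relations on words in the generators `x_1, …, x_{n-1}` (here indexed from `0`). -/
inductive ArtinRel (n : ℕ) : FreeMonoid (Fin (n - 1)) → FreeMonoid (Fin (n - 1)) → Prop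
  | comm (i j : Fin (n - 1)) (h : (i : ℕ) + 1 ≠ j) (h' : (j : ℕ) + 1 ≠ i) :
      ArtinRel n (.of i * .of j) (.of j * .of i)
  | braid (i j : Fin (n - 1)) (h : (i : ℕ) + 1 = j) :
      ArtinRel n (.of j * .of i * .of j) (.of i * .of j * .of i)

/-- The monoid of positive braids on `n` strands. -/
abbrev BraidMonoid (n : ℕ) : Type := PresentedMonoid (ArtinRel n)

/-- The relators `u v⁻¹` of the braid group, one for each Artin relation `u = v`. -/
def artinRelators (n : ℕ) : Set (FreeGroup (Fin (n - 1))) :=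
  {r | ∃ u v, ArtinRel n u v ∧
    r = FreeMonoid.lift FreeGroup.of u * (FreeMonoid.lift FreeGroup.of v)⁻¹}

/-- The Artin braid group on `n` strands. -/
abbrev BraidGroup (n : ℕ) : Type := PresentedGroup (artinRelators n)

/-- The positive braid represented by a word. -/
def ofWord (n : ℕ) : FreeMonoid (Fin (n - 1)) →* BraidMonoid n := PresentedMonoid.mk (ArtinRel n)

/-- The natural map from positive braids to braids. -/
def toBraidGroup (n : ℕ) : BraidMonoid n →* BraidGroup n :=
  PresentedMonoid.lift (fun i => PresentedGroup.of i) (by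
    intro u v h
    have key : ∀ w : FreeMonoid (Fin (n - 1)),
        FreeMonoid.lift (fun i => (PresentedGroup.of i : BraidGroup n)) w
          = PresentedGroup.mk (artinRelators n) (FreeMonoid.lift FreeGroup.of w) := by
      intro w
      rw [← MonoidHom.comp_apply]
      congr 1
      exact FreeMonoid.hom_eq fun _ => rfl
    rw [key, key]
    exact PresentedGroup.mk_eq_mk_of_mul_inv_mem ⟨u, v, h, rfl⟩)

/-- The transposition of the adjacent points `i` and `i + 1`. -/
def adjSwap (n : ℕ) (i : Fin (n - 1)) : Equiv.Perm (Fin n) :=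
  Equiv.swap ⟨i, by omega⟩ ⟨i + 1, by omega⟩

/-- The permutation represented by a word in the adjacent transpositions. -/
def wordPerm (n : ℕ) : FreeMonoid (Fin (n - 1)) →* Equiv.Perm (Fin n) :=
  FreeMonoid.lift (adjSwap n)

theorem wordPerm_eq_of_artinRel (n : ℕ) {u v : FreeMonoid (Fin (n - 1))} (h : ArtinRel n u v) :
    wordPerm n u = wordPerm n v := by
  cases h with
  | comm i j h h' =>
    simp only [wordPerm, map_mul, FreeMonoid.lift_eval_of, adjSwap]
    by_cases hij : i = j
    · rw [hij]
    · have hij' : (i : ℕ) ≠ j := fun e => hij (Fin.ext e)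
      refine (Equiv.Perm.Disjoint.commute ?_).eq
      intro x
      by_cases hx : (x : ℕ) = i ∨ (x : ℕ) = i + 1
      · right
        apply Equiv.swap_apply_of_ne_of_ne <;> rw [Ne, Fin.ext_iff] <;> dsimp only <;> omega
      · left
        apply Equiv.swap_apply_of_ne_of_ne <;> rw [Ne, Fin.ext_iff] <;> dsimp only <;> omega
  | braid i j h =>
    simp only [wordPerm, map_mul, FreeMonoid.lift_eval_of, adjSwap, ← h]
    have hj := j.isLt
    rw [Equiv.swap_mul_swap_mul_swap (by simp) (by simp; omega),
      Equiv.swap_comm (⟨i, _⟩ : Fin n) ⟨i + 1, _⟩,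
      Equiv.swap_comm (⟨i + 1, _⟩ : Fin n) ⟨i + 1 + 1, _⟩,
      Equiv.swap_mul_swap_mul_swap (by simp) (by simp; omega), Equiv.swap_comm]

/-- The canonical projection `x_i ↦ (i, i + 1)` of the braid group to the symmetric group. -/
def toPerm (n : ℕ) : BraidGroup n →* Equiv.Perm (Fin n) :=
  PresentedGroup.toGroup (f := adjSwap n) (by
    rintro r ⟨u, v, h, rfl⟩
    have key : ∀ w : FreeMonoid (Fin (n - 1)),
        FreeGroup.lift (adjSwap n) (FreeMonoid.lift FreeGroup.of w) = wordPerm n w := by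
      intro w
      rw [← MonoidHom.comp_apply]
      congr 1
      exact FreeMonoid.hom_eq fun _ => by simp [wordPerm]
    rw [map_mul, map_inv, key, key, wordPerm_eq_of_artinRel n h, mul_inv_cancel])

/-- The word `x_1 (x_2 x_1) ⋯ (x_{n-1} x_{n-2} ⋯ x_1)`. -/
def garsideWord (n : ℕ) : FreeMonoid (Fin (n - 1)) :=
  FreeMonoid.ofList ((List.finRange (n - 1)).flatMap fun k =>
    ((List.finRange (n - 1)).filter fun i => i ≤ k).reverse)

/-- The Garside braid `Δ_n`. -/
def garside (n : ℕ) : BraidMonoid n := ofWord n (garsideWord n)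

/-- The set `Div(Δ_n)` of divisors of the Garside braid. -/
def garsideDivisors (n : ℕ) : Set (BraidMonoid n) :=
  {α | ∃ δ ε : BraidMonoid n, garside n = δ * α * ε}

/-- The set `SB_n` of simple braids: positive braids represented by a word in which no generator
occurs twice. -/
def simpleBraids (n : ℕ) : Set (BraidMonoid n) :=
  {α | ∃ w : FreeMonoid (Fin (n - 1)), w.toList.Nodup ∧ ofWord n w = α}

/-- A word is reduced if it is a shortest expression of its permutation. -/
def IsReducedWord (n : ℕ) (w : FreeMonoid (Fin (n - 1))) : Prop :=
  ∀ w' : FreeMonoid (Fin (n - 1)), wordPerm n w' = wordPerm n w → w.length ≤ w'.length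

theorem wordPerm_surjective (n : ℕ) : Function.Surjective (wordPerm n) := by
  rw [← MonoidHom.mrange_eq_top, wordPerm, FreeMonoid.mrange_lift]
  cases n with
  | zero => exact Subsingleton.elim _ _
  | succ m => exact Equiv.Perm.mclosure_swap_castSucc_succ m

theorem exists_isReducedWord (n : ℕ) (σ : Equiv.Perm (Fin n)) :
    ∃ w, wordPerm n w = σ ∧ IsReducedWord n w := by
  classical
  have h : ∃ k, ∃ w, wordPerm n w = σ ∧ w.length = k := by
    obtain ⟨w, hw⟩ := wordPerm_surjective n σ
    exact ⟨_, w, hw, rfl⟩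
  obtain ⟨w, hw, hl⟩ := Nat.find_spec h
  exact ⟨w, hw, fun w' hw' => hl ▸ Nat.find_min' h ⟨w', hw'.trans hw, rfl⟩⟩

/-- The positive braid of a permutation `σ`: the braid represented by a reduced word of `σ`. -/
noncomputable def permBraid (n : ℕ) (σ : Equiv.Perm (Fin n)) : BraidMonoid n :=
  ofWord n (exists_isReducedWord n σ).choose

/-- For a set `A` of positive braids, the set `A/∼` of the conjugacy classes of the braid group
which intersect (the image of) `A`. -/
def braidClasses {n : ℕ} (A : Set (BraidMonoid n)) : Set (ConjClasses (BraidGroup n)) :=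
  {c | (c.carrier ∩ toBraidGroup n '' A).Nonempty}

/-- The quotient map `A → A/∼`. -/
def toClass {n : ℕ} (A : Set (BraidMonoid n)) (α : A) : braidClasses A :=
  ⟨ConjClasses.mk (toBraidGroup n α),
    toBraidGroup n α, ConjClasses.mem_carrier_mk, α, α.2, rfl⟩

/-- The inclusion `A/∼ → B/∼` for `A ⊆ B`. -/
def classInclusion {n : ℕ} {A B : Set (BraidMonoid n)} (h : A ⊆ B) :
    braidClasses A → braidClasses B :=
  Set.inclusion fun _ hc => hc.mono (Set.inter_subset_inter_right _ (Set.image_mono h))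

/-- The map induced by the canonical projection, from the conjugacy classes of simple braids to the
conjugacy classes of permutations. -/
def classPerm (n : ℕ) : braidClasses (simpleBraids n) → ConjClasses (Equiv.Perm (Fin n)) :=
  fun c => ConjClasses.map (toPerm n) c

end SimpleBraids

/-! For the bijection `s`: the length of a reduced word is the number of inversions of its
permutation, and any two reduced words of one permutation represent the same positive braid
(Matsumoto, `ofWord_eq_of_isReducedWord`). The word of Δ is reduced and represents the order
reversal, and every reduced word extends to a reduced word of the reversal. Since the Artin
relations preserve permutation and length, the divisors of Δ are exactly the braids of reduced words
(`ofWord_mem_garsideDivisors_iff`), hence are determined by their permutations. Words without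
repeated letters are reduced, so simple braids divide Δ.

For the bijection `π'`: by rotations and far commutations, a word without repetition is conjugate to
its increasing rearrangement, which is a product of intervals of generators separated by gaps, that
is, a composition of `n` (`exists_isConj_blocks`). Adjacent intervals can be exchanged by
conjugating with a power of the Coxeter element δ of the interval that they span
(`semiconjBy_blocks_perm`), so only the underlying partition of `n` matters. An interval of `k`
generators projects to a `(k + 1)`-cycle, so this partition is the cycle type, which classifies
conjugacy in the symmetric group. -/

namespace SimpleBraids

/-! ### Inversions and adjacent transpositions -/

section Length

variable {n : ℕ}

/-- The smaller of the two points exchanged by `adjSwap n i`. -/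
def lowPoint (i : Fin (n - 1)) : Fin n := ⟨i, by omega⟩

/-- The larger of the two points exchanged by `adjSwap n i`. -/
def highPoint (i : Fin (n - 1)) : Fin n := ⟨i + 1, by omega⟩

theorem adjSwap_apply_val (i : Fin (n - 1)) (a : Fin n) :
    (adjSwap n i a : ℕ) = if (a : ℕ) = i then (i : ℕ) + 1 else
      if (a : ℕ) = i + 1 then (i : ℕ) else a := by
  simp only [adjSwap, Equiv.swap_apply_def, Fin.ext_iff]
  split_ifs <;> rfl

@[simp]
theorem adjSwap_lowPoint (i : Fin (n - 1)) : adjSwap n i (lowPoint i) = highPoint i :=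
  Equiv.swap_apply_left _ _

@[simp]
theorem adjSwap_highPoint (i : Fin (n - 1)) : adjSwap n i (highPoint i) = lowPoint i :=
  Equiv.swap_apply_right _ _

@[simp]
theorem adjSwap_mul_self (i : Fin (n - 1)) : adjSwap n i * adjSwap n i = 1 :=
  Equiv.swap_mul_self _ _

@[simp]
theorem mul_adjSwap_mul_adjSwap (σ : Equiv.Perm (Fin n)) (i : Fin (n - 1)) :
    σ * adjSwap n i * adjSwap n i = σ := by
  rw [mul_assoc, adjSwap_mul_self, mul_one]

theorem adjSwap_lt_adjSwap {i : Fin (n - 1)} {a b : Fin n} (h : a < b)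
    (h' : ¬(a = lowPoint i ∧ b = highPoint i)) : adjSwap n i a < adjSwap n i b := by
  simp only [Fin.lt_def, Fin.ext_iff, lowPoint, highPoint, adjSwap_apply_val] at *
  split_ifs <;> omega

/-- The pairs of points whose order is reversed by a permutation. -/
def inversions (σ : Equiv.Perm (Fin n)) : Finset (Fin n × Fin n) :=
  Finset.univ.filter fun p => p.1 < p.2 ∧ σ p.2 < σ p.1

/-- The number of inversions of a permutation. -/
def permLength (σ : Equiv.Perm (Fin n)) : ℕ := (inversions σ).card

theorem mem_inversions {σ : Equiv.Perm (Fin n)} {a b : Fin n} :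
    (a, b) ∈ inversions σ ↔ a < b ∧ σ b < σ a := by
  simp [inversions]

theorem permLength_one : permLength (1 : Equiv.Perm (Fin n)) = 0 := by
  rw [permLength, Finset.card_eq_zero, Finset.eq_empty_iff_forall_notMem]
  rintro ⟨a, b⟩ h
  rw [mem_inversions] at h
  exact lt_asymm h.1 h.2

theorem lowPoint_lt_highPoint (i : Fin (n - 1)) : lowPoint i < highPoint i :=
  Nat.lt_succ_self (i : ℕ)

/-- The transposition keeps the order of every pair but `(lowPoint i, highPoint i)`, so it
transports the old inversions to inversions, and this one pair is new. -/
theorem permLength_mul_of_lt {σ : Equiv.Perm (Fin n)} {i : Fin (n - 1)}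
    (h : σ (lowPoint i) < σ (highPoint i)) :
    permLength (σ * adjSwap n i) = permLength σ + 1 := by
  have key : inversions (σ * adjSwap n i) = insert (lowPoint i, highPoint i)
      ((inversions σ).map ((adjSwap n i).prodCongr (adjSwap n i)).toEmbedding) := by
    ext ⟨a, b⟩
    rw [Finset.mem_insert, Finset.mem_map_equiv, Equiv.prodCongr_symm, Equiv.prodCongr_apply,
      Prod.map_apply, mem_inversions, mem_inversions, Prod.mk.injEq]
    have e : (adjSwap n i).symm = adjSwap n i := Equiv.symm_swap _ _
    rw [e, Equiv.Perm.mul_apply, Equiv.Perm.mul_apply]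
    by_cases hab : a = lowPoint i ∧ b = highPoint i
    · obtain ⟨rfl, rfl⟩ := hab
      simp [h, lowPoint_lt_highPoint]
    · simp only [hab, false_or]
      refine and_congr_left fun hσ => ⟨fun hlt => adjSwap_lt_adjSwap hlt hab, fun hlt => ?_⟩
      by_contra hn
      have hne : a ≠ b := by
        rintro rfl
        exact lt_irrefl _ hσ
      have hba : b < a := lt_of_le_of_ne (not_lt.1 hn) hne.symm
      by_cases hba' : b = lowPoint i ∧ a = highPoint i
      · obtain ⟨rfl, rfl⟩ := hba'
        simp only [adjSwap_lowPoint, adjSwap_highPoint] at hσ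
        exact lt_asymm hσ h
      · exact lt_asymm hlt (adjSwap_lt_adjSwap hba hba')
  rw [permLength, key, Finset.card_insert_of_notMem, Finset.card_map, permLength]
  rw [Finset.mem_map_equiv]
  have e : (adjSwap n i).symm = adjSwap n i := Equiv.symm_swap _ _
  simp [e, mem_inversions, (lowPoint_lt_highPoint i).not_gt]

theorem permLength_mul_of_gt {σ : Equiv.Perm (Fin n)} {i : Fin (n - 1)}
    (h : σ (highPoint i) < σ (lowPoint i)) :
    permLength (σ * adjSwap n i) + 1 = permLength σ := by
  rw [← permLength_mul_of_lt (i := i) (by simpa using h), mul_adjSwap_mul_adjSwap]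

theorem apply_lt_or_gt (σ : Equiv.Perm (Fin n)) (i : Fin (n - 1)) :
    σ (lowPoint i) < σ (highPoint i) ∨ σ (highPoint i) < σ (lowPoint i) :=
  lt_or_gt_of_ne (σ.injective.ne (lowPoint_lt_highPoint i).ne)

theorem permLength_mul_le (σ : Equiv.Perm (Fin n)) (i : Fin (n - 1)) :
    permLength (σ * adjSwap n i) ≤ permLength σ + 1 := by
  rcases apply_lt_or_gt σ i with h | h
  · exact (permLength_mul_of_lt h).le
  · have := permLength_mul_of_gt h
    omega

theorem strictMono_of_forall_lowPoint_lt {f : Fin n → Fin n}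
    (h : ∀ i, f (lowPoint i) < f (highPoint i)) : StrictMono f := by
  cases n with
  | zero => exact fun a => a.elim0
  | succ m => exact Fin.strictMono_iff_lt_succ.2 fun i => h i

/-- Without a descent `σ` would be an order automorphism of `Fin n`, and the identity is the only
one. -/
theorem exists_apply_highPoint_lt {σ : Equiv.Perm (Fin n)} (h : σ ≠ 1) :
    ∃ i, σ (highPoint i) < σ (lowPoint i) := by
  by_contra! hn
  refine h (Equiv.ext fun x => ?_)
  have hm : StrictMono σ := strictMono_of_forall_lowPoint_lt fun i =>
    (hn i).lt_of_ne (σ.injective.ne (lowPoint_lt_highPoint i).ne)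
  exact DFunLike.congr_fun (Subsingleton.elim (hm.orderIsoOfSurjective σ σ.surjective)
    (OrderIso.refl (Fin n))) x

end Length

/-! ### Reduced words and Matsumoto's theorem -/

section ReducedWords

variable {n : ℕ}

@[simp]
theorem wordPerm_of (i : Fin (n - 1)) : wordPerm n (.of i) = adjSwap n i :=
  FreeMonoid.lift_eval_of _ _

theorem exists_eq_mul_of {α : Type*} {w : FreeMonoid α} {k : ℕ} (h : w.length = k + 1) :
    ∃ v a, w = v * .of a ∧ v.length = k := by
  obtain e | ⟨l, a, e⟩ := List.eq_nil_or_concat w.toList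
  · have : w.toList.length = k + 1 := h
    simp [e] at this
  · refine ⟨FreeMonoid.ofList l, a, ?_, ?_⟩
    · apply FreeMonoid.toList.injective
      simpa using e
    · have : w.toList.length = k + 1 := h
      rw [e, List.length_concat] at this
      exact Nat.succ_injective this

theorem permLength_wordPerm_le (w : FreeMonoid (Fin (n - 1))) :
    permLength (wordPerm n w) ≤ w.length := by
  induction hk : w.length generalizing w with
  | zero =>
    rw [FreeMonoid.length_eq_zero.1 hk, map_one, permLength_one]
  | succ k ih =>
    obtain ⟨v, i, rfl, hv⟩ := exists_eq_mul_of hk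
    rw [map_mul, wordPerm_of]
    exact (permLength_mul_le _ _).trans (Nat.succ_le_succ (ih v hv))

/-- Bubble sort: each descent that is undone removes exactly one inversion. -/
theorem exists_word_length_eq (σ : Equiv.Perm (Fin n)) :
    ∃ w, wordPerm n w = σ ∧ w.length = permLength σ := by
  induction hk : permLength σ generalizing σ with
  | zero =>
    refine ⟨1, ?_, FreeMonoid.length_one⟩
    by_contra h
    obtain ⟨i, hi⟩ := exists_apply_highPoint_lt (Ne.symm h)
    have := permLength_mul_of_gt hi
    omega
  | succ k ih =>
    have h : σ ≠ 1 := by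
      rintro rfl
      rw [permLength_one] at hk
      omega
    obtain ⟨i, hi⟩ := exists_apply_highPoint_lt h
    have := permLength_mul_of_gt hi
    obtain ⟨w, hw, hl⟩ := ih (σ * adjSwap n i) (by omega)
    exact ⟨w * .of i, by simp [hw], by simp [hl, FreeMonoid.length_mul]⟩

theorem isReducedWord_iff {w : FreeMonoid (Fin (n - 1))} :
    IsReducedWord n w ↔ w.length = permLength (wordPerm n w) := by
  constructor
  · intro h
    obtain ⟨v, hv, hl⟩ := exists_word_length_eq (wordPerm n w)
    exact le_antisymm (hl ▸ h v hv) (permLength_wordPerm_le w)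
  · intro h w' hw'
    rw [h, ← hw']
    exact permLength_wordPerm_le w'

/-- At an ascent, the prefix `v` would represent a permutation with more inversions than `v` has
letters. -/
theorem wordPerm_gt_of_isReducedWord {v : FreeMonoid (Fin (n - 1))} {i : Fin (n - 1)}
    (h : IsReducedWord n (v * .of i)) :
    wordPerm n (v * .of i) (highPoint i) < wordPerm n (v * .of i) (lowPoint i) := by
  rcases apply_lt_or_gt (wordPerm n (v * .of i)) i with h' | h'
  · exfalso
    have h1 := permLength_mul_of_lt h'
    rw [map_mul, wordPerm_of, mul_adjSwap_mul_adjSwap, ← wordPerm_of, ← map_mul,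
      ← isReducedWord_iff.1 h, FreeMonoid.length_mul, FreeMonoid.length_of] at h1
    have := permLength_wordPerm_le v
    omega
  · exact h'

theorem IsReducedWord.of_mul_of {v : FreeMonoid (Fin (n - 1))} {i : Fin (n - 1)}
    (h : IsReducedWord n (v * .of i)) : IsReducedWord n v := by
  have h1 := permLength_mul_of_gt (wordPerm_gt_of_isReducedWord h)
  rw [← isReducedWord_iff.1 h, map_mul, wordPerm_of, mul_adjSwap_mul_adjSwap,
      FreeMonoid.length_mul, FreeMonoid.length_of] at h1
  exact isReducedWord_iff.2 (Nat.succ_injective h1.symm)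

theorem isReducedWord_mul_of {v : FreeMonoid (Fin (n - 1))} {i : Fin (n - 1)}
    (h : IsReducedWord n v) (hi : wordPerm n v (lowPoint i) < wordPerm n v (highPoint i)) :
    IsReducedWord n (v * .of i) := by
  rw [isReducedWord_iff, map_mul, wordPerm_of, permLength_mul_of_lt hi, ← isReducedWord_iff.1 h,
    FreeMonoid.length_mul, FreeMonoid.length_of]

theorem ofWord_comm {i j : Fin (n - 1)} (h : (i : ℕ) + 1 ≠ j) (h' : (j : ℕ) + 1 ≠ i) :
    ofWord n (.of i * .of j) = ofWord n (.of j * .of i) :=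
  PresentedMonoid.mk_eq_mk_of_rel (ArtinRel.comm i j h h')

theorem ofWord_braid {i j : Fin (n - 1)} (h : (i : ℕ) + 1 = j) :
    ofWord n (.of j * .of i * .of j) = ofWord n (.of i * .of j * .of i) :=
  PresentedMonoid.mk_eq_mk_of_rel (ArtinRel.braid i j h)

theorem adjSwap_comm {i j : Fin (n - 1)} (h : (i : ℕ) + 1 ≠ j) (h' : (j : ℕ) + 1 ≠ i) :
    adjSwap n i * adjSwap n j = adjSwap n j * adjSwap n i := by
  simpa using wordPerm_eq_of_artinRel n (ArtinRel.comm i j h h')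

theorem adjSwap_braid {i j : Fin (n - 1)} (h : (i : ℕ) + 1 = j) :
    adjSwap n j * adjSwap n i * adjSwap n j = adjSwap n i * adjSwap n j * adjSwap n i := by
  simpa using wordPerm_eq_of_artinRel n (ArtinRel.braid i j h)

theorem adjSwap_apply_of_ne {i : Fin (n - 1)} {a : Fin n} (h : (a : ℕ) ≠ i)
    (h' : (a : ℕ) ≠ i + 1) : adjSwap n i a = a := by
  rw [Fin.ext_iff, adjSwap_apply_val, if_neg h, if_neg h']

/-- Two reduced words of the same permutation represent the same positive braid (Matsumoto's
theorem for the symmetric group). -/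
theorem ofWord_eq_of_isReducedWord {u v : FreeMonoid (Fin (n - 1))} (hu : IsReducedWord n u)
    (hv : IsReducedWord n v) (h : wordPerm n u = wordPerm n v) : ofWord n u = ofWord n v := by
  induction hk : u.length using Nat.strong_induction_on generalizing u v with
  | _ k ih =>
  have hlen : u.length = v.length := by
    rw [isReducedWord_iff.1 hu, h, ← isReducedWord_iff.1 hv]
  -- By induction the prefix before a fixed last letter may be replaced by any word of the same
  -- permutation and length.
  have reduce : ∀ {u' t : FreeMonoid (Fin (n - 1))} {i : Fin (n - 1)},
      IsReducedWord n (u' * .of i) → (u' * .of i).length = k →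
      t.length + 1 = k → wordPerm n t = wordPerm n (u' * .of i) * adjSwap n i →
      ofWord n (u' * .of i) = ofWord n (t * .of i) := by
    intro u' t i hu' hl ht he
    have e : wordPerm n u' = wordPerm n t := by
      rw [he, map_mul, wordPerm_of, mul_adjSwap_mul_adjSwap]
    rw [FreeMonoid.length_mul, FreeMonoid.length_of] at hl
    have hr : IsReducedWord n t := by
      rw [isReducedWord_iff, ← e, ← isReducedWord_iff.1 hu'.of_mul_of]
      omega
    rw [map_mul, map_mul, ih u'.length (by omega) hu'.of_mul_of hr e rfl]
  rcases k with _ | k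
  · rw [FreeMonoid.length_eq_zero.1 hk, FreeMonoid.length_eq_zero.1 (hlen.symm.trans hk)]
  obtain ⟨u', i, rfl, hu'⟩ := exists_eq_mul_of hk
  obtain ⟨v', j, rfl, hv'⟩ := exists_eq_mul_of (hlen ▸ hk)
  -- With distant descents `i` and `j`, both can be removed: the words become `t j i` and `t i j`
  -- for a common reduced `t`.
  have far : ∀ {u' v' : FreeMonoid (Fin (n - 1))} {i j : Fin (n - 1)},
      IsReducedWord n (u' * .of i) → IsReducedWord n (v' * .of j) →
      wordPerm n (u' * .of i) = wordPerm n (v' * .of j) →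
      (u' * .of i).length = k + 1 → (v' * .of j).length = k + 1 → (i : ℕ) + 1 < j →
      ofWord n (u' * .of i) = ofWord n (v' * .of j) := by
    intro u' v' i j hu hv h hlu hlv hij
    have di := wordPerm_gt_of_isReducedWord hu
    have dj := wordPerm_gt_of_isReducedWord hv
    rw [← h] at dj
    have hl := isReducedWord_iff.1 hu
    set σ := wordPerm n (u' * .of i)
    have e1 := permLength_mul_of_gt di
    have e2 : permLength (σ * adjSwap n i * adjSwap n j) + 1 = permLength (σ * adjSwap n i) := by
      apply permLength_mul_of_gt
      rw [Equiv.Perm.mul_apply, Equiv.Perm.mul_apply, adjSwap_apply_of_ne, adjSwap_apply_of_ne]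
      · exact dj
      all_goals simp only [lowPoint, highPoint]; omega
    obtain ⟨t, ht, htl⟩ := exists_word_length_eq (σ * adjSwap n i * adjSwap n j)
    have c := adjSwap_comm (n := n) (i := i) (j := j) (by omega) (by omega)
    rw [reduce (t := t * .of j) hu hlu, reduce (t := t * .of i) hv hlv, mul_assoc, mul_assoc,
      map_mul, map_mul _ t, ofWord_comm (by omega) (by omega)]
    · rw [FreeMonoid.length_mul, FreeMonoid.length_of]; omega
    · rw [← h, map_mul, ht, wordPerm_of, mul_assoc σ, c, ← mul_assoc, mul_adjSwap_mul_adjSwap]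
    · rw [FreeMonoid.length_mul, FreeMonoid.length_of]; omega
    · rw [map_mul, ht, wordPerm_of, mul_adjSwap_mul_adjSwap]
  -- With adjacent descents, `σ` reverses three consecutive points, so three letters can be removed:
  -- the words become `t i j i` and `t j i j`.
  have near : ∀ {u' v' : FreeMonoid (Fin (n - 1))} {i j : Fin (n - 1)},
      IsReducedWord n (u' * .of i) → IsReducedWord n (v' * .of j) →
      wordPerm n (u' * .of i) = wordPerm n (v' * .of j) →
      (u' * .of i).length = k + 1 → (v' * .of j).length = k + 1 → (i : ℕ) + 1 = j →
      ofWord n (u' * .of i) = ofWord n (v' * .of j) := by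
    intro u' v' i j hu hv h hlu hlv hij
    have di := wordPerm_gt_of_isReducedWord hu
    have dj := wordPerm_gt_of_isReducedWord hv
    rw [← h] at dj
    have hl := isReducedWord_iff.1 hu
    set σ := wordPerm n (u' * .of i)
    have hji : highPoint i = lowPoint j := Fin.ext hij
    have hlow : adjSwap n j (lowPoint i) = lowPoint i :=
      adjSwap_apply_of_ne (by simp only [lowPoint]; omega) (by simp only [lowPoint]; omega)
    have hhigh : adjSwap n i (highPoint j) = highPoint j :=
      adjSwap_apply_of_ne (by simp only [highPoint]; omega) (by simp only [highPoint]; omega)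
    have e1 := permLength_mul_of_gt di
    have e2 : permLength (σ * adjSwap n i * adjSwap n j) + 1 = permLength (σ * adjSwap n i) := by
      apply permLength_mul_of_gt
      rw [Equiv.Perm.mul_apply, Equiv.Perm.mul_apply, hhigh, ← hji, adjSwap_highPoint]
      exact dj.trans (hji ▸ di)
    have e3 : permLength (σ * adjSwap n i * adjSwap n j * adjSwap n i) + 1 =
        permLength (σ * adjSwap n i * adjSwap n j) := by
      apply permLength_mul_of_gt
      simp only [Equiv.Perm.mul_apply]
      rw [hlow, hji, adjSwap_lowPoint, hhigh, adjSwap_lowPoint, hji]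
      exact dj
    obtain ⟨t, ht, htl⟩ := exists_word_length_eq (σ * adjSwap n i * adjSwap n j * adjSwap n i)
    have c := adjSwap_braid (n := n) hij
    rw [reduce (t := t * .of i * .of j) hu hlu, reduce (t := t * .of j * .of i) hv hlv]
    · have := ofWord_braid (n := n) hij
      simp only [map_mul, mul_assoc] at this ⊢
      rw [this]
    · simp only [FreeMonoid.length_mul, FreeMonoid.length_of]; omega
    · rw [← h, map_mul, map_mul, ht, wordPerm_of, wordPerm_of, mul_assoc σ, mul_assoc σ, ← c,
        ← mul_assoc, mul_adjSwap_mul_adjSwap, ← mul_assoc, mul_adjSwap_mul_adjSwap]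
    · simp only [FreeMonoid.length_mul, FreeMonoid.length_of]; omega
    · rw [map_mul, map_mul, ht, wordPerm_of, wordPerm_of, mul_adjSwap_mul_adjSwap,
        mul_adjSwap_mul_adjSwap]
  rcases lt_trichotomy (i : ℕ) j with hij | hij | hij
  · rcases (Nat.succ_le_of_lt hij).eq_or_lt with e | e
    · exact near hu hv h hk (hlen ▸ hk) e
    · exact far hu hv h hk (hlen ▸ hk) e
  · obtain rfl := Fin.ext hij
    rw [map_mul, map_mul, ih k (Nat.lt_succ_self k) hu.of_mul_of hv.of_mul_of ?_ hu']
    simpa using h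
  · rcases (Nat.succ_le_of_lt hij).eq_or_lt with e | e
    · exact (near hv hu h.symm (hlen ▸ hk) hk e).symm
    · exact (far hv hu h.symm (hlen ▸ hk) hk e).symm

end ReducedWords

/-! ### Divisors of the Garside braid -/

section Garside

variable {n : ℕ}

/-- The action of a word in the adjacent transpositions on the natural numbers. -/
def wordAction (l : List ℕ) (a : ℕ) : ℕ :=
  l.foldr (fun i a => if a = i then i + 1 else if a = i + 1 then i else a) a

theorem wordAction_append (l l' : List ℕ) (a : ℕ) :
    wordAction (l ++ l') a = wordAction l (wordAction l' a) :=
  List.foldr_append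

theorem wordAction_cons (i : ℕ) (l : List ℕ) (a : ℕ) :
    wordAction (i :: l) a = if wordAction l a = i then i + 1 else
      if wordAction l a = i + 1 then i else wordAction l a := rfl

/-- Passing to natural numbers allows inductions over ranges in which the bound `n - 1` plays no
role. -/
theorem wordPerm_apply_val (w : FreeMonoid (Fin (n - 1))) (a : Fin n) :
    (wordPerm n w a : ℕ) = wordAction (w.toList.map Fin.val) a := by
  induction w using FreeMonoid.inductionOn' with
  | one => rfl
  | of_mul i w ih =>
    rw [map_mul, wordPerm_of, Equiv.Perm.mul_apply, adjSwap_apply_val, ih]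
    rfl

theorem wordAction_reverse_range (k a : ℕ) :
    wordAction (List.range k).reverse a = if a = 0 then k else if a ≤ k then a - 1 else a := by
  induction k with
  | zero =>
    simp only [wordAction, List.range_zero, List.reverse_nil, List.foldr_nil]
    split_ifs <;> omega
  | succ k ih =>
    rw [List.range_succ, List.reverse_append, List.reverse_singleton, List.singleton_append,
      wordAction_cons, ih]
    split_ifs <;> omega

/-- The last row acts first: it sends `0` to the top and lowers the other points by one, after which
the shorter reversal applies. -/
theorem wordAction_flatMap_range (m a : ℕ) :
    wordAction ((List.range m).flatMap fun k => (List.range (k + 1)).reverse) a =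
      if a ≤ m then m - a else a := by
  induction m generalizing a with
  | zero =>
    simp only [wordAction, List.range_zero, List.flatMap_nil, List.foldr_nil]
    split_ifs <;> omega
  | succ m ih =>
    rw [List.range_succ, List.flatMap_append, wordAction_append, List.flatMap_singleton,
      wordAction_reverse_range, ih]
    split_ifs <;> omega

theorem filter_le_range {m k : ℕ} (h : k < m) :
    (List.range m).filter (fun i => i ≤ k) = List.range (k + 1) := by
  obtain ⟨r, rfl⟩ := Nat.exists_eq_add_of_lt h
  rw [Nat.add_right_comm, List.range_add, List.filter_append, List.filter_eq_self.2,
    List.filter_eq_nil_iff.2, List.append_nil]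
  · simp only [List.mem_map, decide_eq_true_eq]
    rintro _ ⟨a, -, rfl⟩
    omega
  · simp only [List.mem_range, decide_eq_true_eq]
    omega

theorem map_val_filter_finRange {m : ℕ} (k : Fin m) :
    ((List.finRange m).filter fun i => i ≤ k).map Fin.val = List.range (k + 1) := by
  rw [← filter_le_range k.isLt, ← List.map_coe_finRange_eq_range, List.filter_map]
  rfl

theorem map_val_garsideWord :
    (garsideWord n).toList.map Fin.val =
      (List.range (n - 1)).flatMap fun k => (List.range (k + 1)).reverse := by
  rw [garsideWord, FreeMonoid.toList_ofList, List.map_flatMap, ← List.map_coe_finRange_eq_range,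
    List.flatMap_map]
  congr 1
  ext1 k
  rw [List.map_reverse, map_val_filter_finRange]

theorem wordPerm_garsideWord : wordPerm n (garsideWord n) = Fin.revPerm := by
  ext a
  rw [wordPerm_apply_val, map_val_garsideWord, wordAction_flatMap_range, Fin.revPerm_apply,
    Fin.val_rev]
  split_ifs <;> omega

theorem length_garsideWord : (garsideWord n).length = ∑ i ∈ Finset.range n, i := by
  have h : (garsideWord n).length = ((garsideWord n).toList.map Fin.val).length := by
    rw [List.length_map]
    rfl
  rw [h, map_val_garsideWord, List.length_flatMap]
  simp only [List.length_reverse, List.length_range]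
  cases n with
  | zero => rfl
  | succ m =>
    rw [Finset.sum_range_succ', Nat.add_sub_cancel, add_zero]
    rfl

/-- All pairs `a < b` are inversions; they are counted by their larger point. -/
theorem permLength_revPerm : permLength (Fin.revPerm : Equiv.Perm (Fin n)) =
    ∑ i ∈ Finset.range n, i := by
  rw [permLength, inversions, Finset.card_filter, Fintype.sum_prod_type_right,
    ← Fin.sum_univ_eq_sum_range]
  refine Finset.sum_congr rfl fun b _ => ?_
  rw [← Finset.card_filter, ← Fin.card_Iio b]
  congr 1
  ext a
  simp

theorem isReducedWord_garsideWord : IsReducedWord n (garsideWord n) := by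
  rw [isReducedWord_iff, wordPerm_garsideWord, permLength_revPerm, length_garsideWord]

/-- Composition with the reversal exchanges ascents and descents, so any other permutation has an
ascent, whose letter can be appended. The number of pairs of points bounds the length, so the
process stops. -/
theorem exists_isReducedWord_mul_revPerm {w : FreeMonoid (Fin (n - 1))} (h : IsReducedWord n w) :
    ∃ e, IsReducedWord n (w * e) ∧ wordPerm n (w * e) = Fin.revPerm := by
  have hle : w.length ≤ Fintype.card (Fin n × Fin n) := by
    rw [isReducedWord_iff.1 h]
    exact Finset.card_le_univ _
  induction hk : Fintype.card (Fin n × Fin n) - w.length using Nat.strong_induction_on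
    generalizing w with
  | _ k ih =>
  by_cases hw : wordPerm n w = Fin.revPerm
  · exact ⟨1, by simpa using h, by simpa using hw⟩
  · have hne : Fin.revPerm * wordPerm n w ≠ 1 := by
      intro e
      apply hw
      rw [mul_eq_one_iff_inv_eq] at e
      rw [← e]
      rfl
    obtain ⟨i, hi⟩ := exists_apply_highPoint_lt hne
    rw [Equiv.Perm.mul_apply, Equiv.Perm.mul_apply, Fin.revPerm_apply, Fin.revPerm_apply,
      Fin.rev_lt_rev] at hi
    have hr := isReducedWord_mul_of h hi
    have hlt : (w * .of i).length ≤ Fintype.card (Fin n × Fin n) := by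
      rw [isReducedWord_iff.1 hr]
      exact Finset.card_le_univ _
    have hl : (w * .of i).length = w.length + 1 := by
      rw [FreeMonoid.length_mul, FreeMonoid.length_of]
    obtain ⟨e, he, hp⟩ := ih _ (by omega) hr hlt rfl
    exact ⟨.of i * e, by rwa [← mul_assoc], by rwa [← mul_assoc]⟩

theorem toPerm_toBraidGroup_ofWord (w : FreeMonoid (Fin (n - 1))) :
    toPerm n (toBraidGroup n (ofWord n w)) = wordPerm n w := by
  have h : ((toPerm n).comp (toBraidGroup n)).comp (ofWord n) = wordPerm n := by
    refine FreeMonoid.hom_eq fun i => ?_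
    rw [wordPerm_of]
    exact FreeGroup.lift_apply_of
  exact DFunLike.congr_fun h w

theorem wordPerm_eq_of_ofWord_eq {u v : FreeMonoid (Fin (n - 1))} (h : ofWord n u = ofWord n v) :
    wordPerm n u = wordPerm n v := by
  rw [← toPerm_toBraidGroup_ofWord, h, toPerm_toBraidGroup_ofWord]

/-- The Artin relations are homogeneous, so length is a homomorphism to the additive naturals. -/
theorem length_eq_of_ofWord_eq {u v : FreeMonoid (Fin (n - 1))} (h : ofWord n u = ofWord n v) :
    u.length = v.length := by
  have key : conGen (ArtinRel n) ≤ Con.ker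
      (FreeMonoid.lift fun _ : Fin (n - 1) => Multiplicative.ofAdd (1 : ℕ)) := by
    rw [Con.conGen_le]
    intro u v h
    cases h <;> rfl
  have hl : ∀ w : FreeMonoid (Fin (n - 1)),
      FreeMonoid.lift (fun _ : Fin (n - 1) => Multiplicative.ofAdd (1 : ℕ)) w =
        Multiplicative.ofAdd w.length := by
    intro w
    induction w using FreeMonoid.inductionOn' with
    | one => rfl
    | of_mul i w ih => rw [map_mul, ih, FreeMonoid.length_mul]; rfl
  have := key (PresentedMonoid.mk_eq_mk_iff.1 h)
  rw [Con.ker_rel, hl, hl] at this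
  exact Multiplicative.ofAdd.injective this

theorem IsReducedWord.of_mul_mul {d a e : FreeMonoid (Fin (n - 1))}
    (h : IsReducedWord n (d * a * e)) : IsReducedWord n a := by
  intro a' ha'
  have := h (d * a' * e) (by simp only [map_mul, ha'])
  simp only [FreeMonoid.length_mul] at this
  omega

theorem ofWord_surjective : Function.Surjective (ofWord n) := fun q =>
  PresentedMonoid.inductionOn q fun w => ⟨w, rfl⟩

/-- The divisors of the Garside braid are the positive braids represented by reduced words. -/
theorem ofWord_mem_garsideDivisors_iff {w : FreeMonoid (Fin (n - 1))} :
    ofWord n w ∈ garsideDivisors n ↔ IsReducedWord n w := by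
  constructor
  · rintro ⟨δ, ε, h⟩
    obtain ⟨d, rfl⟩ := ofWord_surjective δ
    obtain ⟨e, rfl⟩ := ofWord_surjective ε
    rw [← map_mul, ← map_mul, garside] at h
    refine IsReducedWord.of_mul_mul (d := d) (e := e) ?_
    rw [isReducedWord_iff, ← wordPerm_eq_of_ofWord_eq h, ← length_eq_of_ofWord_eq h,
      ← isReducedWord_iff]
    exact isReducedWord_garsideWord
  · intro h
    -- The completed word and the word of Δ are reduced words of the reversal; the left cofactor can
    -- be `1`.
    obtain ⟨e, he, hp⟩ := exists_isReducedWord_mul_revPerm h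
    refine ⟨1, ofWord n e, ?_⟩
    rw [one_mul, ← map_mul]
    exact ofWord_eq_of_isReducedWord isReducedWord_garsideWord he
      (wordPerm_garsideWord.trans hp.symm)

theorem permBraid_wordPerm {w : FreeMonoid (Fin (n - 1))} (h : IsReducedWord n w) :
    permBraid n (wordPerm n w) = ofWord n w :=
  ofWord_eq_of_isReducedWord (exists_isReducedWord n _).choose_spec.2 h
    (exists_isReducedWord n _).choose_spec.1

theorem permBraid_mem_garsideDivisors (σ : Equiv.Perm (Fin n)) :
    permBraid n σ ∈ garsideDivisors n :=
  ofWord_mem_garsideDivisors_iff.2 (exists_isReducedWord n σ).choose_spec.2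

theorem toPerm_toBraidGroup_permBraid (σ : Equiv.Perm (Fin n)) :
    toPerm n (toBraidGroup n (permBraid n σ)) = σ :=
  (toPerm_toBraidGroup_ofWord _).trans (exists_isReducedWord n σ).choose_spec.1

theorem permBraid_toPerm_toBraidGroup {α : BraidMonoid n} (h : α ∈ garsideDivisors n) :
    permBraid n (toPerm n (toBraidGroup n α)) = α := by
  obtain ⟨w, rfl⟩ := ofWord_surjective α
  rw [toPerm_toBraidGroup_ofWord, permBraid_wordPerm (ofWord_mem_garsideDivisors_iff.1 h)]

/-- Only the letter `i` moves a point across the cut between `i` and `i + 1`. -/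
theorem wordPerm_apply_le_iff {w : FreeMonoid (Fin (n - 1))} {i : Fin (n - 1)}
    (h : i ∉ w.toList) (a : Fin n) : (wordPerm n w a : ℕ) ≤ i ↔ (a : ℕ) ≤ i := by
  induction w using FreeMonoid.inductionOn' with
  | one => rfl
  | of_mul j w ih =>
    rw [FreeMonoid.toList_of_mul, List.mem_cons, not_or, Fin.ext_iff] at h
    rw [← ih h.2, map_mul, wordPerm_of, Equiv.Perm.mul_apply, adjSwap_apply_val]
    have := h.1
    split_ifs <;> omega

/-- The last letter `i` is absent from the prefix, which therefore respects the cut above `i` and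
has an ascent there. -/
theorem isReducedWord_of_nodup {w : FreeMonoid (Fin (n - 1))} (h : w.toList.Nodup) :
    IsReducedWord n w := by
  induction hk : w.length generalizing w with
  | zero =>
    intro w' _
    rw [hk]
    exact Nat.zero_le _
  | succ k ih =>
    obtain ⟨v, i, rfl, hv⟩ := exists_eq_mul_of hk
    rw [FreeMonoid.toList_mul, FreeMonoid.toList_of, ← List.concat_eq_append,
      List.nodup_concat] at h
    refine isReducedWord_mul_of (ih h.2 hv) ?_
    have h1 := (wordPerm_apply_le_iff h.1 (lowPoint i)).2 le_rfl
    have h2 := (wordPerm_apply_le_iff h.1 (highPoint i)).not.2 (Nat.not_succ_le_self _)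
    exact h1.trans_lt (not_le.1 h2)

theorem simpleBraids_subset_garsideDivisors : simpleBraids n ⊆ garsideDivisors n := by
  rintro _ ⟨w, hw, rfl⟩
  exact ofWord_mem_garsideDivisors_iff.2 (isReducedWord_of_nodup hw)

end Garside

/-! ### Sorting words without repeated letters -/

section CoxeterLists

/-- Lists related by cyclic rotations and exchanges of adjacent letters which are not neighbours. -/
inductive RotateExchange : List ℕ → List ℕ → Prop
  | refl (w : List ℕ) : RotateExchange w w
  | symm {w w' : List ℕ} : RotateExchange w w' → RotateExchange w' w
  | trans {w w' w'' : List ℕ} :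
      RotateExchange w w' → RotateExchange w' w'' → RotateExchange w w''
  | rotate (i : ℕ) (w : List ℕ) : RotateExchange (i :: w) (w ++ [i])
  | exchange (u v : List ℕ) {i j : ℕ} (h : i + 2 ≤ j) :
      RotateExchange (u ++ i :: j :: v) (u ++ j :: i :: v)

namespace RotateExchange

theorem perm {w w' : List ℕ} (h : RotateExchange w w') : w.Perm w' := by
  induction h with
  | refl w => exact .refl w
  | symm _ ih => exact ih.symm
  | trans _ _ ih ih' => exact ih.trans ih'
  | rotate i w => exact (List.perm_append_singleton i w).symm
  | exchange u v _ => exact (List.Perm.swap _ _ v).append_left u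

theorem append_comm (u v : List ℕ) : RotateExchange (u ++ v) (v ++ u) := by
  induction u generalizing v with
  | nil => simpa using refl v
  | cons i u ih =>
    refine (rotate i (u ++ v)).trans ?_
    simpa using ih (v ++ [i])

theorem append_cons {a : ℕ} {u : List ℕ} (v : List ℕ) (h : ∀ i ∈ u, a + 2 ≤ i) :
    RotateExchange (u ++ a :: v) (a :: (u ++ v)) := by
  induction u using List.reverseRecOn generalizing v with
  | nil => exact refl _
  | append_singleton u i ih =>
    refine .trans (w' := u ++ a :: i :: v) ?_ ?_
    · simpa using (exchange u v (h i (by simp))).symm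
    · simpa using ih (i :: v) fun j hj => h j (by simp [hj])

/-- Only a rotation of `i` needs an argument. If `a + 2 ≤ i`, the letter `i` first passes `a`. If `i
= a + 1`, the pair `a, a + 1` is rotated as a whole, and `a` returns to the front past letters that
are all at least `a + 2`, by distinctness. -/
theorem cons {w w' : List ℕ} (h : RotateExchange w w') {a : ℕ} (hw : ∀ i ∈ w, a < i)
    (hd : w.Nodup) : RotateExchange (a :: w) (a :: w') := by
  induction h with
  | refl w => exact refl _
  | symm h ih => exact (ih (fun i hi => hw i (h.perm.subset hi)) (h.perm.nodup_iff.2 hd)).symm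
  | trans h _ ih ih' =>
    exact (ih hw hd).trans
      (ih' (fun i hi => hw i (h.perm.symm.subset hi)) (h.perm.nodup_iff.1 hd))
  | exchange u v h => exact exchange (a :: u) v h
  | rotate i w =>
    have hi := hw i (by simp)
    rcases (Nat.succ_le_of_lt hi).eq_or_lt with e | e
    · subst e
      refine (append_comm [a, a + 1] w).trans ?_
      refine append_cons [a + 1] fun j hj => ?_
      have h1 := hw j (by simp [hj])
      have h2 : j ≠ a + 1 := by
        rintro rfl
        exact (List.nodup_cons.1 hd).1 hj
      omega
    · exact (exchange [] w e).trans (rotate i (a :: w))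

end RotateExchange

/-- The least letter is rotated to the front; the moves that sort the rest lift by
`RotateExchange.cons`. -/
theorem exists_rotateExchange_sorted (w : List ℕ) (hd : w.Nodup) :
    ∃ w', RotateExchange w w' ∧ w'.Pairwise (· < ·) := by
  induction hk : w.length generalizing w with
  | zero => exact ⟨w, .refl w, by simp [List.length_eq_zero_iff.1 hk]⟩
  | succ k ih =>
    have hne : w ≠ [] := by
      rintro rfl
      simp at hk
    obtain ⟨a, ha, hmin⟩ : ∃ a ∈ w, ∀ i ∈ w, a ≤ i := by
      have h : ∃ a, a ∈ w := List.exists_mem_of_ne_nil w hne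
      classical
      exact ⟨Nat.find h, Nat.find_spec h, fun i hi => Nat.find_min' h hi⟩
    obtain ⟨u, v, rfl⟩ := List.append_of_mem ha
    have hp : (u ++ a :: v).Perm (a :: (v ++ u)) := (RotateExchange.append_comm u (a :: v)).perm
    have hd' := hp.nodup_iff.1 hd
    rw [List.nodup_cons] at hd'
    obtain ⟨w', hw', hs⟩ := ih (v ++ u) hd'.2 (by
      rw [hp.length_eq] at hk
      exact Nat.succ_injective hk)
    have hlt : ∀ i ∈ v ++ u, a < i := fun i hi =>
      lt_of_le_of_ne (hmin i (hp.symm.subset (List.mem_cons_of_mem a hi))) fun e => hd'.1 (e ▸ hi)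
    exact ⟨a :: w', (RotateExchange.append_comm u (a :: v)).trans (hw'.cons hlt hd'.2),
      List.pairwise_cons.2 ⟨fun i hi => hlt i (hw'.perm.symm.subset hi), hs⟩⟩

/-- Successive intervals of generators, of the given lengths, starting at `a` and such that one
generator is left out between two successive intervals. -/
def blocks : ℕ → List ℕ → List ℕ
  | _, [] => []
  | a, k :: L => List.range' a k ++ blocks (a + k + 1) L

theorem bounds_of_mem_blocks {a i : ℕ} {L : List ℕ} (h : i ∈ blocks a L) :
    a ≤ i ∧ i + 1 < a + (L.map (· + 1)).sum := by
  induction L generalizing a with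
  | nil => simp [blocks] at h
  | cons k L ih =>
    rw [blocks, List.mem_append, List.mem_range'_1] at h
    rw [List.map_cons, List.sum_cons]
    rcases h with h | h
    · omega
    · have := ih h
      omega

theorem sorted_blocks (a : ℕ) (L : List ℕ) : (blocks a L).Pairwise (· < ·) := by
  induction L generalizing a with
  | nil => exact .nil
  | cons k L ih =>
    refine List.pairwise_append.2 ⟨List.pairwise_lt_range', ih _, fun i hi j hj => ?_⟩
    have := bounds_of_mem_blocks hj
    rw [List.mem_range'_1] at hi
    omega

/-- An interval of `k` generators occupies `k + 1` points, so `L` encodes a composition of the `m`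
points from `a` on. The point `a` lengthens the first block if `a ∈ w`, and otherwise forms a block
of length `0`. -/
theorem exists_blocks_eq {a m : ℕ} {w : List ℕ} (hw : w.Pairwise (· < ·))
    (h : ∀ i ∈ w, a ≤ i ∧ i + 1 < a + m) : ∃ L, blocks a L = w ∧ (L.map (· + 1)).sum = m := by
  induction m generalizing a w with
  | zero =>
    refine ⟨[], ?_, rfl⟩
    rw [blocks, eq_comm, List.eq_nil_iff_forall_not_mem]
    intro i hi
    have := h i hi
    omega
  | succ m ih =>
    by_cases ha : a ∈ w
    · obtain ⟨w', rfl⟩ : ∃ w', w = a :: w' := by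
        cases w with
        | nil => simp at ha
        | cons b w' =>
          rcases List.mem_cons.1 ha with rfl | hb
          · exact ⟨w', rfl⟩
          · have := (List.pairwise_cons.1 hw).1 a hb
            have := (h b (by simp)).1
            omega
      rw [List.pairwise_cons] at hw
      obtain ⟨L, hL, hs⟩ := ih (a := a + 1) hw.2 fun i hi => by
        have := hw.1 i hi
        have := h i (by simp [hi])
        omega
      cases L with
      | nil =>
        have := h a (by simp)
        simp only [List.map_nil, List.sum_nil] at hs
        omega
      | cons k L =>
        refine ⟨(k + 1) :: L, ?_, ?_⟩
        · rw [← hL, blocks, blocks, List.range'_succ, List.cons_append]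
          congr 3
          omega
        · simp only [List.map_cons, List.sum_cons] at hs ⊢
          omega
    · obtain ⟨L, hL, hs⟩ := ih (a := a + 1) hw fun i hi => by
        have := h i hi
        have : i ≠ a := by
          rintro rfl
          exact ha hi
        omega
      refine ⟨0 :: L, ?_, ?_⟩
      · rw [← hL, blocks]
        simp
      · simp only [List.map_cons, List.sum_cons, hs]
        omega

end CoxeterLists

/-! ### Conjugacy of products of blocks -/

section BraidSequence

variable {G : Type*} [Group G] {N : ℕ} {g : ℕ → G}

/-- A sequence in a group whose first `N` terms satisfy the Artin relations. -/
structure IsBraidSequence (N : ℕ) (g : ℕ → G) : Prop where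
  commute : ∀ i j, i + 2 ≤ j → Commute (g i) (g j)
  braid : ∀ i, i + 1 < N → g i * g (i + 1) * g i = g (i + 1) * g i * g (i + 1)

/-- The product of the terms of a sequence at the indices in a list. -/
def seqProd (g : ℕ → G) (w : List ℕ) : G := (w.map g).prod

@[simp]
theorem seqProd_nil : seqProd g [] = 1 := rfl

@[simp]
theorem seqProd_cons (i : ℕ) (w : List ℕ) : seqProd g (i :: w) = g i * seqProd g w :=
  List.prod_cons

@[simp]
theorem seqProd_append (u v : List ℕ) : seqProd g (u ++ v) = seqProd g u * seqProd g v := by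
  rw [seqProd, List.map_append, List.prod_append, seqProd, seqProd]

theorem commute_seqProd {x : G} {w : List ℕ} (h : ∀ i ∈ w, Commute x (g i)) :
    Commute x (seqProd g w) := by
  refine Commute.list_prod_right _ _ fun y hy => ?_
  obtain ⟨i, hi, rfl⟩ := List.mem_map.1 hy
  exact h i hi

theorem semiconjBy_seqProd_range' {x : G} {a b k : ℕ}
    (h : ∀ j < k, SemiconjBy x (g (a + j)) (g (b + j))) :
    SemiconjBy x (seqProd g (List.range' a k)) (seqProd g (List.range' b k)) := by
  induction k with
  | zero => simp
  | succ k ih =>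
    rw [List.range'_concat, List.range'_concat, seqProd_append, seqProd_append]
    simpa using (ih fun j hj => h j (by omega)).mul_right (h k (by omega))

theorem isConj_of_semiconjBy {c x y : G} (h : SemiconjBy c x y) : IsConj x y :=
  ⟨toUnits c, h⟩

namespace IsBraidSequence

variable (hg : IsBraidSequence N g)
include hg

theorem isConj_of_rotateExchange {w w' : List ℕ} (h : RotateExchange w w') :
    IsConj (seqProd g w) (seqProd g w') := by
  induction h with
  | refl w => exact IsConj.refl _
  | symm _ ih => exact ih.symm
  | trans _ _ ih ih' => exact ih.trans ih'
  | rotate i w =>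
    rw [seqProd_cons, seqProd_append, seqProd_cons, seqProd_nil, mul_one]
    refine isConj_of_semiconjBy (c := (g i)⁻¹) ?_
    rw [SemiconjBy, inv_mul_cancel_left, mul_inv_cancel_right]
  | exchange u v h =>
    simp only [seqProd_append, seqProd_cons]
    rw [← mul_assoc (g _), (hg.commute _ _ h).eq, mul_assoc]

/-- Moving left through δ, the letter `g i` meets `g i * g (i + 1)`, where the braid relation makes
it `g (i + 1)`, which then slides to the front. -/
theorem semiconjBy_range' {a m i : ℕ} (ha : a ≤ i) (hi : i + 1 < a + m) (hm : a + m ≤ N) :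
    SemiconjBy (seqProd g (List.range' a m)) (g i) (g (i + 1)) := by
  obtain ⟨p, rfl⟩ := Nat.exists_eq_add_of_le ha
  obtain ⟨q, rfl⟩ : ∃ q, m = p + (q + 2) := ⟨m - p - 2, by omega⟩
  have h1 : Commute (g (a + p + 1)) (seqProd g (List.range' a p)) := commute_seqProd fun i hi => by
    rw [List.mem_range'_1] at hi
    exact (hg.commute _ _ (by omega)).symm
  have h2 : Commute (g (a + p)) (seqProd g (List.range' (a + p + 1 + 1) q)) :=
    commute_seqProd fun i hi => by
      rw [List.mem_range'_1] at hi
      exact hg.commute _ _ (by omega)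
  have h3 := hg.braid (a + p) (by omega)
  rw [← List.range'_append_1, List.range'_succ, List.range'_succ, seqProd_append, seqProd_cons,
    seqProd_cons, SemiconjBy]
  calc _ = seqProd g (List.range' a p) * (g (a + p) * g (a + p + 1) *
        (seqProd g (List.range' (a + p + 1 + 1) q) * g (a + p))) := by simp only [mul_assoc]
    _ = seqProd g (List.range' a p) * (g (a + p) * g (a + p + 1) * g (a + p) *
        seqProd g (List.range' (a + p + 1 + 1) q)) := by rw [← h2.eq]; simp only [mul_assoc]
    _ = seqProd g (List.range' a p) * g (a + p + 1) * (g (a + p) * g (a + p + 1) *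
        seqProd g (List.range' (a + p + 1 + 1) q)) := by rw [h3]; simp only [mul_assoc]
    _ = _ := by rw [← h1.eq]; simp only [mul_assoc]

theorem semiconjBy_range'_pow {a m i : ℕ} (r : ℕ) (ha : a ≤ i) (hi : i + r < a + m)
    (hm : a + m ≤ N) : SemiconjBy (seqProd g (List.range' a m) ^ r) (g i) (g (i + r)) := by
  induction r with
  | zero => simp
  | succ r ih =>
    rw [pow_succ']
    have h := hg.semiconjBy_range' (a := a) (m := m) (i := i + r) (by omega) (by omega) hm
    exact h.mul_left (ih (by omega))

/-- Write δ as `g a * P'` and as `P * g (a + m)`. The shift gives `δ * P = P' * δ`, so `δ² * g (a +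
m) = g a * δ * P * g (a + m) = g a * δ²`. -/
theorem semiconjBy_range'_sq {a m : ℕ} (hm : a + m < N) :
    SemiconjBy (seqProd g (List.range' a (m + 1)) ^ 2) (g (a + m)) (g a) := by
  have h := semiconjBy_seqProd_range' (g := g) (x := seqProd g (List.range' a (m + 1)))
    (a := a) (b := a + 1) (k := m) fun j hj => by
      rw [Nat.add_right_comm]
      exact hg.semiconjBy_range' (by omega) (by omega) (by omega)
  have h1 : seqProd g (List.range' a (m + 1)) = g a * seqProd g (List.range' (a + 1) m) := by
    rw [List.range'_succ, seqProd_cons]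
  have h2 : seqProd g (List.range' a (m + 1)) = seqProd g (List.range' a m) * g (a + m) := by
    rw [List.range'_concat, seqProd_append]
    simp
  rw [SemiconjBy, pow_two]
  set d := seqProd g (List.range' a (m + 1))
  calc d * d * g (a + m) = g a * (seqProd g (List.range' (a + 1) m) * d) * g (a + m) := by
        nth_rw 1 [h1]
        simp only [mul_assoc]
    _ = g a * (d * (seqProd g (List.range' a m) * g (a + m))) := by
        rw [← h.eq]
        simp only [mul_assoc]
    _ = g a * (d * d) := by rw [← h2]

/-- Commutation of `c` with the generators up to `a - 2` lets the induction put a further block in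
front. -/
theorem semiconjBy_blocks_perm {L L' : List ℕ} (h : L.Perm L') (a : ℕ)
    (ha : a + (L.map (· + 1)).sum ≤ N + 1) :
    ∃ c, (∀ i, i + 2 ≤ a → Commute c (g i)) ∧
      SemiconjBy c (seqProd g (blocks a L)) (seqProd g (blocks a L')) := by
  induction h generalizing a with
  | nil => exact ⟨1, fun i _ => Commute.one_left _, SemiconjBy.one_left _⟩
  | trans h _ ih ih' =>
    obtain ⟨c, hc, hs⟩ := ih a ha
    obtain ⟨c', hc', hs'⟩ := ih' a (by rwa [← (h.map _).sum_eq])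
    exact ⟨c' * c, fun i hi => (hc' i hi).mul_left (hc i hi), hs'.mul_left hs⟩
  | cons k h ih =>
    rw [List.map_cons, List.sum_cons] at ha
    obtain ⟨c, hc, hs⟩ := ih (a + k + 1) (by omega)
    refine ⟨c, fun i hi => hc i (by omega), ?_⟩
    rw [blocks, blocks, seqProd_append, seqProd_append]
    refine SemiconjBy.mul_right (commute_seqProd fun i hi => hc i ?_) hs
    rw [List.mem_range'_1] at hi
    omega
  | swap k l L =>
    simp only [List.map_cons, List.sum_cons] at ha
    -- Conjugation by δ shifts generators by one, so its power `k + 1` carries the first block to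
    -- its new place.
    refine ⟨seqProd g (List.range' a (l + k + 1)) ^ (k + 1), fun i hi => ?_, ?_⟩
    · refine (Commute.pow_right (commute_seqProd fun j hj => ?_) _).symm
      rw [List.mem_range'_1] at hj
      exact hg.commute _ _ (by omega)
    have h1 : SemiconjBy (seqProd g (List.range' a (l + k + 1)) ^ (k + 1))
        (seqProd g (List.range' a l)) (seqProd g (List.range' (a + k + 1) l)) := by
      refine semiconjBy_seqProd_range' fun j hj => ?_
      have := hg.semiconjBy_range'_pow (a := a) (m := l + k + 1) (i := a + j) (k + 1)
        (by omega) (by omega) (by omega)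
      convert this using 2
      omega
    have h2 : SemiconjBy (seqProd g (List.range' a (l + k + 1)) ^ (k + 1))
        (seqProd g (List.range' (a + l + 1) k)) (seqProd g (List.range' a k)) := by
      refine semiconjBy_seqProd_range' fun j hj => ?_
      -- The second block wraps around: `k - 1 - j` shifts reach the top generator, `δ²` returns it
      -- to `a`, and `j` shifts remain, `k + 1` factors in all.
      have e1 := hg.semiconjBy_range'_pow (a := a) (m := l + k + 1) (i := a + l + 1 + j)
        (k - 1 - j) (by omega) (by omega) (by omega)
      have e2 := hg.semiconjBy_range'_sq (a := a) (m := l + k) (by omega)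
      have e3 := hg.semiconjBy_range'_pow (a := a) (m := l + k + 1) (i := a)
        j (by omega) (by omega) (by omega)
      rw [show a + l + 1 + j + (k - 1 - j) = a + (l + k) by omega] at e1
      have := e3.mul_left (e2.mul_left e1)
      rwa [← pow_add, ← pow_add, show j + (2 + (k - 1 - j)) = k + 1 by omega] at this
    have h3 : Commute (seqProd g (List.range' a (l + k + 1)) ^ (k + 1))
        (seqProd g (blocks (a + l + 1 + k + 1) L)) := by
      refine (Commute.pow_right (commute_seqProd fun j hj => ?_) _).symm
      refine (commute_seqProd fun i hi => ?_).symm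
      have := bounds_of_mem_blocks hi
      rw [List.mem_range'_1] at hj
      exact hg.commute _ _ (by omega)
    have h4 : Commute (seqProd g (List.range' (a + k + 1) l)) (seqProd g (List.range' a k)) := by
      refine commute_seqProd fun j hj => (commute_seqProd fun i hi => ?_).symm
      rw [List.mem_range'_1] at hi hj
      exact hg.commute _ _ (by omega)
    simp only [blocks, seqProd_append]
    rw [← mul_assoc, ← mul_assoc, ← h4.eq, show a + k + 1 + l + 1 = a + l + 1 + k + 1 by omega]
    exact (h1.mul_right h2).mul_right h3

theorem exists_isConj_blocks {w : List ℕ} (hd : w.Nodup) (hw : ∀ i ∈ w, i < N) :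
    ∃ L, (L.map (· + 1)).sum = N + 1 ∧ IsConj (seqProd g w) (seqProd g (blocks 0 L)) := by
  obtain ⟨w', hw', hs⟩ := exists_rotateExchange_sorted w hd
  obtain ⟨L, rfl, hL⟩ := exists_blocks_eq (a := 0) (m := N + 1) hs fun i hi => by
    have := hw i (hw'.perm.symm.subset hi)
    omega
  exact ⟨L, hL, hg.isConj_of_rotateExchange hw'⟩

theorem isConj_blocks_of_perm {L L' : List ℕ} (h : L.Perm L')
    (hL : (L.map (· + 1)).sum = N + 1) :
    IsConj (seqProd g (blocks 0 L)) (seqProd g (blocks 0 L')) := by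
  obtain ⟨c, -, hc⟩ := hg.semiconjBy_blocks_perm h 0 (by omega)
  exact isConj_of_semiconjBy hc

end IsBraidSequence

end BraidSequence

/-! ### Simple braids up to conjugacy and cycle types -/

section ConjugacyClasses

/-- The generators of the braid group, continued by `1` to a sequence. -/
def braidSeq (n i : ℕ) : BraidGroup n :=
  if h : i < n - 1 then toBraidGroup n (ofWord n (.of ⟨i, h⟩)) else 1

/-- The adjacent transpositions, continued by `1` to a sequence. -/
def swapSeq (n i : ℕ) : Equiv.Perm (Fin n) :=
  if h : i < n - 1 then adjSwap n ⟨i, h⟩ else 1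

variable {n : ℕ}

/-- The padding by `1` respects commutation everywhere; braid relations are required only between
true generators. -/
theorem isBraidSequence_braidSeq : IsBraidSequence (n - 1) (braidSeq n) where
  commute i j h := by
    simp only [braidSeq]
    split_ifs with hi hj
    · rw [Commute, SemiconjBy, ← map_mul, ← map_mul, ← map_mul, ← map_mul,
        ofWord_comm (by simp only; omega) (by simp only; omega)]
    · exact Commute.one_right _
    · exact Commute.one_left _
    · exact Commute.one_left _
  braid i h := by
    have hb := ofWord_braid (n := n) (i := ⟨i, by omega⟩) (j := ⟨i + 1, h⟩) rfl
    rw [braidSeq, braidSeq, dif_pos h, dif_pos (by omega)]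
    simp only [← map_mul, hb]

theorem toBraidGroup_ofWord (w : FreeMonoid (Fin (n - 1))) :
    toBraidGroup n (ofWord n w) = seqProd (braidSeq n) (w.toList.map Fin.val) := by
  induction w using FreeMonoid.inductionOn' with
  | one => simp
  | of_mul i w ih =>
    rw [map_mul, map_mul, ih, FreeMonoid.toList_of_mul, List.map_cons, seqProd_cons, braidSeq,
      dif_pos i.isLt]

theorem toPerm_seqProd (w : List ℕ) :
    toPerm n (seqProd (braidSeq n) w) = seqProd (swapSeq n) w := by
  induction w with
  | nil => simp
  | cons i w ih =>
    rw [seqProd_cons, seqProd_cons, map_mul, ih, braidSeq, swapSeq]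
    split_ifs with h
    · rw [toPerm_toBraidGroup_ofWord, wordPerm_of]
    · rw [map_one]

theorem exists_map_val_eq {w : List ℕ} (h : ∀ i ∈ w, i < n - 1) :
    ∃ v : FreeMonoid (Fin (n - 1)), v.toList.map Fin.val = w := by
  lift w to List (Fin (n - 1)) using h
  exact ⟨FreeMonoid.ofList w, rfl⟩

theorem exists_eq_mk_blocks {c : ConjClasses (BraidGroup (n + 1))}
    (hc : c ∈ braidClasses (simpleBraids (n + 1))) :
    ∃ L : List ℕ, (L.map (· + 1)).sum = n + 1 ∧
      c = ConjClasses.mk (seqProd (braidSeq (n + 1)) (blocks 0 L)) := by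
  obtain ⟨_, hx, _, ⟨w, hw, rfl⟩, rfl⟩ := hc
  rw [ConjClasses.mem_carrier_iff_mk_eq, toBraidGroup_ofWord] at hx
  obtain ⟨L, hL, h⟩ := (isBraidSequence_braidSeq (n := n + 1)).exists_isConj_blocks
    (hw.map Fin.val_injective) fun i hi => by
      obtain ⟨j, -, rfl⟩ := List.mem_map.1 hi
      exact j.isLt
  exact ⟨L, hL, hx ▸ ConjClasses.mk_eq_mk_iff_isConj.2 h⟩

theorem mk_blocks_mem_braidClasses {L : List ℕ} (hL : (L.map (· + 1)).sum = n) :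
    ConjClasses.mk (seqProd (braidSeq n) (blocks 0 L)) ∈ braidClasses (simpleBraids n) := by
  obtain ⟨v, hv⟩ := exists_map_val_eq (n := n) (w := blocks 0 L) fun i hi => by
    have := bounds_of_mem_blocks hi
    omega
  refine ⟨_, ConjClasses.mem_carrier_mk, ofWord n v, ⟨v, ?_, rfl⟩, ?_⟩
  · apply List.Nodup.of_map Fin.val
    rw [hv]
    exact (sorted_blocks 0 L).imp ne_of_lt
  · rw [toBraidGroup_ofWord, hv]

theorem swapSeq_eq {i : ℕ} (h : i < n) :
    swapSeq (n + 1) i = Equiv.swap (Fin.ofNat (n + 1) i) (Fin.ofNat (n + 1) (i + 1)) := by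
  rw [swapSeq, dif_pos (by simpa using h), adjSwap]
  congr 1
  · exact Fin.ext (Nat.mod_eq_of_lt (by omega)).symm
  · exact Fin.ext (Nat.mod_eq_of_lt (by omega)).symm

theorem seqProd_swapSeq_range' {a k : ℕ} (h : a + k ≤ n) :
    seqProd (swapSeq (n + 1)) (List.range' a k) =
      ((List.range' a (k + 1)).map (Fin.ofNat (n + 1))).formPerm := by
  induction k generalizing a with
  | zero => simp
  | succ k ih =>
    rw [List.range'_succ, seqProd_cons, ih (by omega), swapSeq_eq (by omega),
      List.range'_succ (s := a), List.range'_succ]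
    rfl

theorem nodup_map_ofNat_range' {a k : ℕ} (h : a + k ≤ n + 1) :
    ((List.range' a k).map (Fin.ofNat (n + 1))).Nodup := by
  refine List.Nodup.map_on (fun x hx y hy e => ?_) List.nodup_range'
  rw [List.mem_range'_1] at hx hy
  have := congrArg Fin.val e
  simpa [Nat.mod_eq_of_lt (show x < n + 1 by omega), Nat.mod_eq_of_lt (show y < n + 1 by omega)]
    using this

theorem cycleType_seqProd_range' {a k : ℕ} (h : a + k ≤ n) :
    (seqProd (swapSeq (n + 1)) (List.range' a k)).cycleType =
      (([k + 1].filter (2 ≤ ·) : List ℕ) : Multiset ℕ) := by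
  rw [seqProd_swapSeq_range' h]
  have hd := nodup_map_ofNat_range' (n := n) (a := a) (k := k + 1) (by omega)
  rcases k with _ | k
  · simp
  · have hl : ((List.range' a (k + 1 + 1)).map (Fin.ofNat (n + 1))).length = k + 2 := by simp
    rw [(List.isCycle_formPerm hd (by omega)).cycleType, List.support_formPerm_of_nodup _ hd,
      List.toFinset_card_of_nodup hd, hl]
    · simp
    · intro x hx
      rw [hx] at hl
      simp at hl

theorem seqProd_swapSeq_apply {w : List ℕ} {x : Fin n} (h : ∀ i ∈ w, (x : ℕ) < i) :
    seqProd (swapSeq n) w x = x := by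
  induction w with
  | nil => rfl
  | cons i w ih =>
    rw [seqProd_cons, Equiv.Perm.mul_apply, ih fun j hj => h j (by simp [hj]), swapSeq]
    have := h i (by simp)
    split_ifs
    · exact adjSwap_apply_of_ne (by simp only; omega) (by simp only; omega)
    · rfl

theorem cycleType_seqProd_blocks {a : ℕ} {L : List ℕ} (h : a + (L.map (· + 1)).sum ≤ n + 1) :
    (seqProd (swapSeq (n + 1)) (blocks a L)).cycleType =
      (((L.map (· + 1)).filter (2 ≤ ·) : List ℕ) : Multiset ℕ) := by
  induction L generalizing a with
  | nil => simp [blocks]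
  | cons k L ih =>
    rw [List.map_cons, List.sum_cons] at h
    rw [blocks, seqProd_append, Equiv.Perm.Disjoint.cycleType_mul,
      cycleType_seqProd_range' (by omega), ih (by omega), Multiset.coe_add, ← List.filter_append]
    · rfl
    · intro x
      by_cases hx : (x : ℕ) ≤ a + k
      · refine Or.inr (seqProd_swapSeq_apply fun i hi => ?_)
        have := bounds_of_mem_blocks hi
        omega
      · rw [seqProd_swapSeq_range' (by omega)]
        refine Or.inl (List.formPerm_apply_of_notMem fun hm => hx ?_)
        obtain ⟨i, hi, rfl⟩ := List.mem_map.1 hm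
        rw [List.mem_range'_1] at hi
        rw [Fin.val_ofNat]
        exact (Nat.mod_le _ _).trans (by omega)

/-- Cycle types omit fixed points, which are the zeros of `L`; the total recovers their number. -/
theorem perm_of_filter_perm {L L' : List ℕ} (h1 : (L.map (· + 1)).sum = (L'.map (· + 1)).sum)
    (h2 : ((L.map (· + 1)).filter (2 ≤ ·)).Perm ((L'.map (· + 1)).filter (2 ≤ ·))) :
    L.Perm L' := by
  have split : ∀ L : List ℕ, (L.map (· + 1)).sum =
      ((L.map (· + 1)).filter (2 ≤ ·)).sum + L.count 0 := by
    intro L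
    induction L with
    | nil => rfl
    | cons k L ih =>
      rw [List.map_cons, List.sum_cons, ih]
      rcases k with _ | k
      · simp
        omega
      · simp
        omega
  have count : ∀ (L : List ℕ) (k : ℕ), L.count (k + 1) =
      ((L.map (· + 1)).filter (2 ≤ ·)).count (k + 2) := by
    intro L k
    rw [List.count_filter (by simp)]
    exact (List.count_map_of_injective L (· + 1) (add_left_injective 1) (k + 1)).symm
  rw [List.perm_iff_count]
  rintro (_ | k)
  · have e1 := split L
    have e2 := split L'
    have := h2.sum_eq
    omega
  · rw [count L, count L', h2.count_eq]

theorem classPerm_injective : Function.Injective (classPerm (n + 1)) := by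
  rintro ⟨c, hc⟩ ⟨c', hc'⟩ h
  obtain ⟨L, hL, rfl⟩ := exists_eq_mk_blocks hc
  obtain ⟨L', hL', rfl⟩ := exists_eq_mk_blocks hc'
  have hconj : IsConj (toPerm (n + 1) (seqProd (braidSeq (n + 1)) (blocks 0 L)))
      (toPerm (n + 1) (seqProd (braidSeq (n + 1)) (blocks 0 L'))) :=
    ConjClasses.mk_eq_mk_iff_isConj.1 h
  rw [toPerm_seqProd, toPerm_seqProd, Equiv.Perm.isConj_iff_cycleType_eq,
    cycleType_seqProd_blocks (by omega), cycleType_seqProd_blocks (by omega),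
    Multiset.coe_eq_coe] at hconj
  exact Subtype.ext (ConjClasses.mk_eq_mk_iff_isConj.2
    (isBraidSequence_braidSeq.isConj_blocks_of_perm
      (perm_of_filter_perm (hL.trans hL'.symm) hconj) hL))

/-- Each part of the cycle partition, fixed points included, becomes a block with one generator
fewer. -/
theorem classPerm_surjective : Function.Surjective (classPerm (n + 1)) := by
  intro c
  obtain ⟨σ, rfl⟩ := ConjClasses.exists_rep c
  have hL : (σ.partition.parts.toList.map (· - 1)).map (· + 1) = σ.partition.parts.toList := by
    rw [List.map_map]
    refine (List.map_congr_left fun i hi => ?_).trans (List.map_id _)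
    have := σ.partition.parts_pos (Multiset.mem_toList.1 hi)
    simp only [Function.comp_apply, id_eq]
    omega
  have hs : ((σ.partition.parts.toList.map (· - 1)).map (· + 1)).sum = n + 1 := by
    rw [hL, Multiset.sum_toList, σ.partition.parts_sum, Fintype.card_fin]
  refine ⟨⟨_, mk_blocks_mem_braidClasses hs⟩, ?_⟩
  refine (ConjClasses.mk_eq_mk_iff_isConj (α := Equiv.Perm (Fin (n + 1)))).2 ?_
  rw [toPerm_seqProd, Equiv.Perm.isConj_iff_cycleType_eq, cycleType_seqProd_blocks (by omega), hL,
    ← Multiset.filter_coe, Multiset.coe_toList, Equiv.Perm.filter_parts_partition_eq_cycleType]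

end ConjugacyClasses

end SimpleBraids

open SimpleBraids in
theorem mainTheorem5 (n : ℕ) (hn : 1 ≤ n) :
    -- the maps into `Div(Δ_n)` are well defined
    ∃ (hSB : simpleBraids n ⊆ garsideDivisors n)
      (hs : ∀ σ : Equiv.Perm (Fin n), permBraid n σ ∈ garsideDivisors n),
      -- the upper arrows
      let i₁ : simpleBraids n → garsideDivisors n := Set.inclusion hSB
      let i₂ : garsideDivisors n → BraidMonoid n := Subtype.val
      let ι : BraidMonoid n → BraidGroup n := toBraidGroup n
      let π : BraidGroup n → Equiv.Perm (Fin n) := toPerm n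
      let s : Equiv.Perm (Fin n) → garsideDivisors n := fun σ => ⟨permBraid n σ, hs σ⟩
      -- the vertical arrows
      let qS : simpleBraids n → braidClasses (simpleBraids n) := toClass _
      let qD : garsideDivisors n → braidClasses (garsideDivisors n) := toClass _
      let qM : BraidMonoid n → braidClasses (n := n) Set.univ := fun α => toClass _ ⟨α, trivial⟩
      let qB : BraidGroup n → ConjClasses (BraidGroup n) := ConjClasses.mk
      let qP : Equiv.Perm (Fin n) → ConjClasses (Equiv.Perm (Fin n)) := ConjClasses.mk
      -- the lower arrows
      let j₁ : braidClasses (simpleBraids n) → braidClasses (garsideDivisors n) :=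
        classInclusion hSB
      let j₂ : braidClasses (garsideDivisors n) → braidClasses (n := n) Set.univ :=
        classInclusion (Set.subset_univ _)
      let j₃ : braidClasses (n := n) Set.univ → ConjClasses (BraidGroup n) := Subtype.val
      let j₄ : ConjClasses (BraidGroup n) → ConjClasses (Equiv.Perm (Fin n)) :=
        ConjClasses.map (toPerm n)
      let π' : braidClasses (simpleBraids n) → ConjClasses (Equiv.Perm (Fin n)) := classPerm n
      -- `s σ` is represented by each reduced word of `σ`
      (∀ w, IsReducedWord n w → (s (wordPerm n w) : BraidMonoid n) = ofWord n w) ∧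
      -- the diagram commutes
      qD ∘ i₁ = j₁ ∘ qS ∧
      qM ∘ i₂ = j₂ ∘ qD ∧
      qB ∘ ι = j₃ ∘ qM ∧
      qP ∘ π = j₄ ∘ qB ∧
      π' = j₄ ∘ j₃ ∘ j₂ ∘ j₁ ∧
      π' ∘ qS = qP ∘ π ∘ ι ∘ i₂ ∘ i₁ ∧
      π ∘ ι ∘ i₂ ∘ s = id ∧
      s ∘ π ∘ ι ∘ i₂ = id ∧
      -- the two bijections
      Function.Bijective s ∧
      Function.Bijective π' := by
  refine ⟨simpleBraids_subset_garsideDivisors, permBraid_mem_garsideDivisors, ?_⟩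
  intro i₁ i₂ ι π s qS qD qM qB qP j₁ j₂ j₃ j₄ π'
  have hπs : π ∘ ι ∘ i₂ ∘ s = id := funext toPerm_toBraidGroup_permBraid
  have hsπ : s ∘ π ∘ ι ∘ i₂ = id :=
    funext fun α => Subtype.ext (permBraid_toPerm_toBraidGroup α.2)
  refine ⟨fun w hw => permBraid_wordPerm hw, rfl, rfl, rfl, rfl, rfl, rfl, hπs, hsπ, ?_, ?_⟩
  · exact ⟨Function.LeftInverse.injective (g := π ∘ ι ∘ i₂) (congrFun hπs),
      Function.RightInverse.surjective (g := π ∘ ι ∘ i₂) (congrFun hsπ)⟩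
  · obtain ⟨m, rfl⟩ := Nat.exists_eq_add_of_le' hn
    exact ⟨classPerm_injective, classPerm_surjective⟩
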